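/- Let $H$ be a connected graph on $k$ vertices, let $\theta\ge 1$, and let $S\subseteq\mathbb{R}^d$ satisfy $S=-S$ and $B(0,1)\subseteq S\subseteq B(0,\theta)$, where $B(x,r)$ is the closed Euclidean ball. Let $(\rho_t)_{t\in\mathbb{N}}$, $\mathbb{N}=\{1,2,\dots\}$, be positive real numbers with $\rho_t\to0$ as $t\to\infty$. Let $\mu$ be a measure on $\mathbb{R}^d$ with Lebesgue density $m:\mathbb{R}^d\to[0,\infty)$, and for $t\in\mathbb{N}$ let $\eta_t$ be a Poisson point process on $\mathbb{R}^d$ with intensity measure $t\mu$. Let $\mathfrak{G}_{\rho_tS}(\eta_t)$ be the graph with vertex set $\eta_t$ in which distinct points $x,y$ are joined by an edge whenever $x-y\in\rho_tS$, and let $$N_t=\sum_{(x_1,\dots,x_k)}\frac{|\{\text{subgraphs } H' \text{ of } \mathfrak{G}_{\rho_tS}(\{x_1,\dots,x_k\}) : H'\cong H\}|}{k!}\in[0,\infty],$$ the sum running over all $k$-tuples of pairwise distinct points of $\eta_t$, be the number of (not necessarily induced) subgraphs of $\mathfrak{G}_{\rho_tS}(\eta_t)$ isomorphic to $H$. Assume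 that $m$ is bounded and that there is a constant $c\ge1$ such that $$m(x)\le c\,m(y)\quad\text{whenever}\quad \|x-y\|\le \operatorname{diam}(H)\,\theta\,\sup_{t\in\mathbb{N}}\rho_t,$$ where $\operatorname{diam}(H)$ is the graph diameter of $H$. Then, for every $t\in\mathbb{N}$, the random variable $N_t$ is almost surely finite if and only if $$\int_{\mathbb{R}^d}m(x)^k\,dx<\infty.$$ -/

import Mathlib

open MeasureTheory ProbabilityTheory Filter Topology
open scoped ENNReal NNReal Nat Pointwise

/-- Euclidean space `ℝᵈ` (Euclidean norm, Borel sets, Lebesgue measure `volume`). -/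
abbrev RSpace (d : ℕ) : Type := EuclideanSpace ℝ (Fin d)

/-- The space of locally finite point configurations in `ℝᵈ`: sets with finitely many points in
every bounded set. -/
def PointConfig (d : ℕ) : Type :=
  {ξ : Set (RSpace d) // ∀ B : Set (RSpace d), Bornology.IsBounded B → (ξ ∩ B).Finite}

/-- The number `ξ(A) ∈ ℕ ∪ {∞}` of points of `ξ` in `A`. -/
noncomputable def PointConfig.count {d : ℕ} (A : Set (RSpace d)) (ξ : PointConfig d) : ℕ∞ :=
  (ξ.1 ∩ A).encard

/-- The σ-algebra generated by the maps `ξ ↦ ξ(A)`, `A` Borel. -/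
noncomputable instance PointConfig.instMeasurableSpace (d : ℕ) : MeasurableSpace (PointConfig d) :=
  ⨆ (A : Set (RSpace d)) (_ : MeasurableSet A),
    MeasurableSpace.comap (PointConfig.count A) inferInstance

/-- `η` is a Poisson point process with intensity measure `μ`, defined on `(Ω, P)`: a random
element of the space of locally finite configurations such that `η(A)` is Poisson distributed with
mean `μ(A)` for every Borel set `A` with `μ(A) < ∞`, and such that `η(A₁), …, η(Aₙ)` are
independent for pairwise disjoint Borel sets `A₁, …, Aₙ`.  (For σ-finite `μ` it follows that
`η(A) = ∞` almost surely when `μ(A) = ∞`.) -/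
structure IsPoissonProcess {d : ℕ} {Ω : Type*} [MeasurableSpace Ω] (P : Measure Ω)
    (η : Ω → PointConfig d) (μ : Measure (RSpace d)) : Prop where
  measurable : Measurable η
  law : ∀ A : Set (RSpace d), MeasurableSet A → μ A < ∞ → ∀ n : ℕ,
    P {ω | (η ω).count A = n} =
      ENNReal.ofReal (Real.exp (-(μ A).toReal) * (μ A).toReal ^ n / (n ! : ℝ))
  indep : ∀ (n : ℕ) (A : Fin n → Set (RSpace d)), (∀ i, MeasurableSet (A i)) →
    Pairwise (fun i j => Disjoint (A i) (A j)) →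
    iIndepFun (fun i ω => (η ω).count (A i)) P

/-- `ξ^k_≠`: the `k`-tuples of pairwise distinct points of `ξ`. -/
def distinctTuples {d : ℕ} (k : ℕ) (ξ : Set (RSpace d)) : Set (Fin k → RSpace d) :=
  {x | (∀ i, x i ∈ ξ) ∧ Function.Injective x}

/-- The U-statistic `∑_{x ∈ ξ^k_≠} f(x) ∈ [0, ∞]` of order `k` with non-negative kernel `f`. -/
noncomputable def uStatistic {d k : ℕ} (f : (Fin k → RSpace d) → ℝ≥0) (ξ : PointConfig d) :
    ℝ≥0∞ :=
  ∑' x : distinctTuples k ξ.1, (f x.1 : ℝ≥0∞)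

/-- The geometric graph `𝔊_S(ξ)` with vertex set `ξ`: two distinct points `x`, `y` are joined by an
edge whenever `x - y ∈ S` (for `S = -S`, the same as `y - x ∈ S`). -/
def geometricGraph {d : ℕ} (S ξ : Set (RSpace d)) : SimpleGraph ξ :=
  SimpleGraph.fromRel fun x y => (x : RSpace d) - (y : RSpace d) ∈ S

/-- The kernel of the subgraph count: the number of (not necessarily induced) subgraphs of
`𝔊_S({x₁, …, x_k})` that are isomorphic to `H`, divided by `k!`. -/
noncomputable def subgraphKernel {d k : ℕ} (S : Set (RSpace d)) (H : SimpleGraph (Fin k))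
    (x : Fin k → RSpace d) : ℝ≥0 :=
  (Nat.card {H' : (geometricGraph S (Set.range x)).Subgraph // Nonempty (H'.coe ≃g H)} : ℝ≥0) /
    (k ! : ℝ≥0)

/-- The subgraph count of `H` in `𝔊_S(ξ)`, a number in `[0, ∞]`. -/
noncomputable def subgraphCount {d k : ℕ} (S : Set (RSpace d)) (H : SimpleGraph (Fin k))
    (ξ : PointConfig d) : ℝ≥0∞ :=
  uStatistic (subgraphKernel S H) ξ

/-! Fix `t` and write `ν` for the intensity measure. `ℝᵈ` is cut into small lattice cells of equal
volume, and `N_t` is compared with the point counts in cells.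

If `∫ m^k < ∞`: as `H` is connected, each copy of `H` lies in a neighbourhood `T n` of a cell, of
fixed radius. Hence `N_t` is at most a constant times the number of `k`-tuples of distinct points in
single sets `T n`. The mean of this number is `∑ ν(T n)^k` (factorial moments of Poisson variables).
By Hölder this is at most a constant times `∑ ∫_{T n} m^k`, and so a multiple of `∫ m^k`, since the
`T n` overlap boundedly often. A finite mean gives almost sure finiteness.

If `∫ m^k = ∞`: take cells of diameter at most `ρ t`, so that any `k` points in one cell span a
complete graph and contain `H`. Since `m` is bounded, a cell `Q n` holds exactly `k` points with
probability at least `ε ν(Q n)^k`; comparability of `m` makes this at least a multiple of `∫_{Q n}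
m^k`. The probabilities sum to `∞`, and counts in disjoint cells are independent. The second
Borel–Cantelli lemma gives infinitely many such cells almost surely, hence `N_t = ∞`. -/

/-! ### The subgraph kernel: locality and two-sided bounds -/

theorem dist_le_length_mul_of_walk {d : ℕ} {S ξ : Set (RSpace d)} {r : ℝ}
    (hS : S ⊆ Metric.closedBall 0 r) {u v : ξ} (w : (geometricGraph S ξ).Walk u v) :
    dist (u : RSpace d) v ≤ w.length * r := by
  induction w with
  | nil => simp
  | @cons a b e hab p ih =>
    have h1 : dist (a : RSpace d) b ≤ r := by
      rw [geometricGraph, SimpleGraph.fromRel_adj] at hab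
      rcases hab.2 with h | h
      · simpa [dist_eq_norm] using hS h
      · rw [dist_comm]; simpa [dist_eq_norm] using hS h
    have h2 := dist_triangle (a : RSpace d) b e
    rw [SimpleGraph.Walk.length_cons]
    push_cast
    linarith

theorem dist_le_of_iso_subgraph {d k : ℕ} {S : Set (RSpace d)} {r : ℝ} (hr : 0 ≤ r)
    (hS : S ⊆ Metric.closedBall 0 r) {H : SimpleGraph (Fin k)} (hH : H.Connected)
    {x : Fin k → RSpace d} {H' : (geometricGraph S (Set.range x)).Subgraph}
    (e : H'.coe ≃g H) (i j : Fin k) : dist (x i) (x j) ≤ k * r := by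
  -- `H'` has `k` vertices and the host graph at most `k`, so `H'` is spanning and every `x l` is
  -- one of its vertices.
  have hverts : H'.verts = Set.univ := by
    refine Set.eq_univ_of_univ_subset
      (Set.eq_of_subset_of_ncard_le (Set.subset_univ _) ?_ Set.finite_univ).ge
    have h1 : H'.verts.ncard = k := by
      rw [← Nat.card_coe_set_eq, Nat.card_congr e.toEquiv, Nat.card_fin]
    rw [h1, Set.ncard_univ]
    simpa using Finite.card_range_le x
  have hmem : ∀ l : Fin k, (⟨x l, l, rfl⟩ : Set.range x) ∈ H'.verts := by simp [hverts]
  obtain ⟨w, hw⟩ := (hH.preconnected (e ⟨_, hmem i⟩) (e ⟨_, hmem j⟩)).exists_isPath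
  have hlen : w.length < k := by simpa using hw.length_lt
  let w' := (w.map e.symm.toHom).map H'.hom
  have hw' : w'.length = w.length :=
    (SimpleGraph.Walk.length_map _ _).trans (SimpleGraph.Walk.length_map _ _)
  have hd := dist_le_length_mul_of_walk hS w'
  rw [hw'] at hd
  have e1 : ∀ l, H'.hom (e.symm.toHom (e ⟨_, hmem l⟩)) = ⟨x l, l, rfl⟩ := by
    intro l
    change H'.hom (e.symm (e ⟨_, hmem l⟩)) = _
    rw [e.symm_apply_apply]; rfl
  rw [e1, e1] at hd
  refine hd.trans (mul_le_mul_of_nonneg_right ?_ hr)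
  exact_mod_cast hlen.le

theorem dist_le_of_subgraphKernel_ne_zero {d k : ℕ} {S : Set (RSpace d)} {r : ℝ} (hr : 0 ≤ r)
    (hS : S ⊆ Metric.closedBall 0 r) {H : SimpleGraph (Fin k)} (hH : H.Connected)
    {x : Fin k → RSpace d} (hx : subgraphKernel S H x ≠ 0) (i j : Fin k) :
    dist (x i) (x j) ≤ k * r := by
  have h : Nat.card {H' : (geometricGraph S (Set.range x)).Subgraph // Nonempty (H'.coe ≃g H)}
      ≠ 0 := by
    intro h0
    exact hx (by simp [subgraphKernel, h0])
  obtain ⟨⟨H', ⟨e⟩⟩⟩ := (Nat.card_ne_zero.mp h).1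
  exact dist_le_of_iso_subgraph hr hS hH e i j

/-- A subgraph is determined by its vertex set and its adjacency relation. Only uniformity in `x`
matters. -/
theorem subgraphKernel_le {d k : ℕ} (S : Set (RSpace d)) (H : SimpleGraph (Fin k))
    (x : Fin k → RSpace d) : subgraphKernel S H x ≤ 2 ^ k * 2 ^ (k * k) := by
  have hfact : (1 : ℝ≥0) ≤ (k ! : ℝ≥0) := by exact_mod_cast Nat.factorial_pos k
  refine (div_le_self (by positivity) hfact).trans ?_
  have hcard : Nat.card (Set.range x) ≤ k := by simpa using Finite.card_range_le x
  set V := Set.range x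
  have h1 : Nat.card {H' : (geometricGraph S V).Subgraph // Nonempty (H'.coe ≃g H)} ≤
      Nat.card (Set V × Set (V × V)) := by
    refine Nat.card_le_card_of_injective
      (fun H' => (H'.1.verts, {p : V × V | H'.1.Adj p.1 p.2})) ?_
    intro H₁ H₂ h
    simp only [Prod.mk.injEq] at h
    refine Subtype.ext (SimpleGraph.Subgraph.ext h.1 ?_)
    ext a b
    exact Set.ext_iff.mp h.2 (a, b)
  have h2 : Nat.card (Set V × Set (V × V)) ≤ 2 ^ k * 2 ^ (k * k) := by
    have : Fintype V := Fintype.ofFinite V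
    classical
    rw [Nat.card_prod, Nat.card_eq_fintype_card, Nat.card_eq_fintype_card, Fintype.card_set,
      Fintype.card_set, Fintype.card_prod, ← Nat.card_eq_fintype_card]
    gcongr <;> norm_num
  exact_mod_cast h1.trans h2

/-- The geometric graph is then complete on `k` vertices, so it contains at least one copy of `H`.
-/
theorem le_subgraphKernel {d k : ℕ} {S : Set (RSpace d)} (H : SimpleGraph (Fin k))
    {x : Fin k → RSpace d} (hx : Function.Injective x) (hS : ∀ i j, x i - x j ∈ S) :
    (1 : ℝ≥0) / (k ! : ℝ≥0) ≤ subgraphKernel S H x := by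
  have hc : 1 ≤ Nat.card
      {H' : (geometricGraph S (Set.range x)).Subgraph // Nonempty (H'.coe ≃g H)} := by
    let f : H.Copy (geometricGraph S (Set.range x)) :=
      ⟨⟨fun i => ⟨x i, i, rfl⟩, fun {a b} hab => by
        rw [geometricGraph, SimpleGraph.fromRel_adj]
        exact ⟨fun h => hab.ne (hx (Subtype.ext_iff.mp h)), Or.inl (hS a b)⟩⟩,
        fun a b h => hx (Subtype.ext_iff.mp h)⟩
    have : Finite (geometricGraph S (Set.range x)).Subgraph := inferInstance
    refine Nat.card_pos_iff.mpr ⟨⟨⟨f.toSubgraph, ⟨f.isoToSubgraph.symm⟩⟩⟩, inferInstance⟩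
  unfold subgraphKernel
  gcongr
  exact_mod_cast hc

/-! ### Bounding U-statistics by counts in cells -/

theorem encard_distinctTuples {d : ℕ} (k : ℕ) {ξ : Set (RSpace d)} (hξ : ξ.Finite) :
    (distinctTuples k ξ).encard = ((ξ.ncard.descFactorial k : ℕ) : ℕ∞) := by
  have : Fintype ξ := hξ.fintype
  let e : distinctTuples k ξ ≃ (Fin k ↪ ξ) :=
    { toFun := fun x => ⟨fun i => ⟨x.1 i, x.2.1 i⟩, fun i j h => x.2.2 (Subtype.ext_iff.mp h)⟩
      invFun := fun f => ⟨fun i => f i, fun i => (f i).2,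
        fun i j h => f.injective (Subtype.ext h)⟩
      left_inv := fun x => rfl
      right_inv := fun f => rfl }
  rw [← ENat.card_coe_set_eq, ENat.card_congr e, ENat.card_eq_coe_fintype_card,
    Fintype.card_embedding_eq, Fintype.card_fin, ← Nat.card_eq_fintype_card,
    Nat.card_coe_set_eq]

/-- A `U`-statistic whose kernel charges only tuples contained in one of the sets `A n` is bounded
by the numbers of tuples of distinct points in these sets. -/
theorem uStatistic_le_tsum_encard {d k : ℕ} {f : (Fin k → RSpace d) → ℝ≥0} {K : ℝ≥0}
    (hK : ∀ x, f x ≤ K) {A : ℕ → Set (RSpace d)}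
    (hA : ∀ x, f x ≠ 0 → ∃ n, ∀ i, x i ∈ A n) (ξ : PointConfig d) :
    uStatistic f ξ ≤ K * ∑' n, ((distinctTuples k (ξ.1 ∩ A n)).encard : ℝ≥0∞) := by
  simp_rw [← ENNReal.tsum_set_one, tsum_subtype _ (fun _ => (1 : ℝ≥0∞))]
  rw [ENNReal.tsum_comm, ← ENNReal.tsum_mul_left, uStatistic,
    tsum_subtype (distinctTuples k ξ.1) (fun x => (f x : ℝ≥0∞))]
  refine ENNReal.tsum_le_tsum fun x => ?_
  by_cases hx : x ∈ distinctTuples k ξ.1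
  · rw [Set.indicator_of_mem hx]
    by_cases h0 : f x = 0
    · simp [h0]
    · obtain ⟨n, hn⟩ := hA x h0
      have hmem : x ∈ distinctTuples k (ξ.1 ∩ A n) := ⟨fun i => ⟨hx.1 i, hn i⟩, hx.2⟩
      calc (f x : ℝ≥0∞) ≤ K * 1 := by rw [mul_one]; exact_mod_cast hK x
        _ ≤ _ := by
          gcongr
          refine le_trans ?_ (ENNReal.le_tsum n)
          rw [Set.indicator_of_mem hmem]
  · rw [Set.indicator_of_notMem hx]
    exact zero_le

/-- If infinitely many of the disjoint sets `A n` contain exactly `k ≥ 1` points of `ξ`, and the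
kernel is bounded below on tuples in a single `A n`, then the `U`-statistic is infinite. -/
theorem uStatistic_eq_top {d k : ℕ} (hk : 0 < k) {f : (Fin k → RSpace d) → ℝ≥0} {ε : ℝ≥0}
    (hε : ε ≠ 0) {A : ℕ → Set (RSpace d)} (hdisj : Pairwise (Function.onFun Disjoint A))
    (hA : ∀ n x, Function.Injective x → (∀ i, x i ∈ A n) → ε ≤ f x) {ξ : PointConfig d}
    (hξ : {n | ξ.count (A n) = k}.Infinite) : uStatistic f ξ = ∞ := by
  have hex : ∀ n : {n | ξ.count (A n) = k},
      ∃ x : distinctTuples k ξ.1, ∀ i, x.1 i ∈ A n := by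
    rintro ⟨n, hn⟩
    have hn' : (ξ.1 ∩ A n).encard = k := hn
    have hfin : (ξ.1 ∩ A n).Finite := Set.finite_of_encard_eq_coe hn'
    have : Finite ↑(ξ.1 ∩ A n) := hfin
    have hcard : Nat.card ↑(ξ.1 ∩ A n) = k := by
      rw [Nat.card_coe_set_eq, Set.ncard, hn', ENat.toNat_natCast]
    let e := (Finite.equivFinOfCardEq hcard).symm
    exact ⟨⟨fun i => e i, fun i => (e i).2.1, fun i j h => e.injective (Subtype.ext h)⟩,
      fun i => (e i).2.2⟩
  choose g hg using hex
  -- Tuples from different cells differ already in their first entry, which exists because `k ≥ 1`.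
  have hginj : Function.Injective g := by
    intro a b hab
    by_contra hne
    have h2 := hg b ⟨0, hk⟩
    rw [← hab] at h2
    exact Set.disjoint_left.mp (hdisj fun h => hne (Subtype.ext h)) (hg a ⟨0, hk⟩) h2
  have : Infinite {n | ξ.count (A n) = k} := hξ.to_subtype
  refine top_unique ?_
  calc (∞ : ℝ≥0∞) = ∑' _ : {n | ξ.count (A n) = k}, (ε : ℝ≥0∞) :=
        (ENNReal.tsum_const_eq_top_of_ne_zero (by exact_mod_cast hε)).symm
    _ ≤ ∑' n, (f (g n).1 : ℝ≥0∞) := by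
        refine ENNReal.tsum_le_tsum fun n => ?_
        exact_mod_cast hA n _ (g n).2.2 (hg n)
    _ ≤ _ := ENNReal.tsum_comp_le_tsum_of_injective hginj _

/-! ### Lattice cells and bounded overlap -/

/-- The half-open cube of side `s` with index `i` in the lattice partition of `ℝᵈ`. -/
def latticeCube (d : ℕ) (s : ℝ) (i : Fin d → ℤ) : Set (RSpace d) :=
  {x | ∀ j, s * i j ≤ x j ∧ x j < s * (i j + 1)}

theorem latticeCube_eq_preimage (d : ℕ) (s : ℝ) (i : Fin d → ℤ) :
    latticeCube d s i = (MeasurableEquiv.toLp 2 (Fin d → ℝ)).symm ⁻¹'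
      (Set.univ.pi fun j => Set.Ico (s * i j) (s * (i j + 1))) := by
  ext x
  simp [latticeCube]

theorem measurableSet_latticeCube (d : ℕ) (s : ℝ) (i : Fin d → ℤ) :
    MeasurableSet (latticeCube d s i) := by
  rw [latticeCube_eq_preimage]
  exact (MeasurableEquiv.measurable _) (MeasurableSet.univ_pi fun j => measurableSet_Ico)

theorem volume_latticeCube (d : ℕ) (s : ℝ) (i : Fin d → ℤ) :
    volume (latticeCube d s i) = ENNReal.ofReal s ^ d := by
  rw [latticeCube_eq_preimage,
    (EuclideanSpace.volume_preserving_symm_measurableEquiv_toLp (Fin d)).measure_preimage_equiv,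
    Real.volume_pi_Ico]
  simp [mul_add]

theorem mem_latticeCube_iff {d : ℕ} {s : ℝ} (hs : 0 < s) {i : Fin d → ℤ} {x : RSpace d} :
    x ∈ latticeCube d s i ↔ (fun j => ⌊x j / s⌋) = i := by
  rw [funext_iff]
  refine forall_congr' fun j => ?_
  rw [Int.floor_eq_iff, le_div_iff₀ hs, div_lt_iff₀ hs, mul_comm s, mul_comm s]

theorem dist_le_of_mem_latticeCube {d : ℕ} {s : ℝ} (hs : 0 < s) {i : Fin d → ℤ} {x y : RSpace d}
    (hx : x ∈ latticeCube d s i) (hy : y ∈ latticeCube d s i) : dist x y ≤ (d + 1) * s := by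
  rw [EuclideanSpace.dist_eq]
  refine Real.sqrt_le_iff.mpr ⟨by positivity, ?_⟩
  calc ∑ j, dist (x j) (y j) ^ 2 ≤ ∑ _j : Fin d, s ^ 2 := by
        refine Finset.sum_le_sum fun j _ => ?_
        have h : dist (x j) (y j) ≤ s := by
          have := hx j; have := hy j
          rw [Real.dist_eq, abs_le]
          constructor <;> linarith
        gcongr
    _ = d * s ^ 2 := by simp
    _ ≤ ((d + 1) * s) ^ 2 := by
        rw [mul_pow]
        gcongr
        nlinarith [(Nat.cast_nonneg d : (0 : ℝ) ≤ d)]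

/-- A sequence of cells partitioning `ℝᵈ`, of small diameter and of the same positive volume
(up to the empty cells). -/
theorem exists_partition (d : ℕ) {r : ℝ} (hr : 0 < r) :
    ∃ (Q : ℕ → Set (RSpace d)) (V : ℝ≥0∞), V ≠ 0 ∧ V ≠ ∞ ∧ (∀ n, MeasurableSet (Q n)) ∧
      Pairwise (Function.onFun Disjoint Q) ∧ (⋃ n, Q n) = Set.univ ∧
      (∀ n, ∀ x ∈ Q n, ∀ y ∈ Q n, dist x y ≤ r) ∧ ∀ n, Q n = ∅ ∨ volume (Q n) = V := by
  -- A cube of side `s` has diameter at most `√d * s ≤ (d + 1) * s`; using `d + 1` also covers `d =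
  -- 0`.
  set s : ℝ := r / (d + 1) with hs_def
  have hs : 0 < s := by positivity
  have hsr : (d + 1) * s = r := by rw [hs_def]; field_simp
  refine ⟨fun n => ⋃ i ∈ Encodable.decode₂ (Fin d → ℤ) n, latticeCube d s i,
    ENNReal.ofReal s ^ d, ?_, ?_, ?_, ?_, ?_, ?_, ?_⟩
  · simp [hs]
  · simp
  · exact fun n => Encodable.iUnion_decode₂_cases (C := MeasurableSet) MeasurableSet.empty
      fun i => measurableSet_latticeCube d s i
  · refine Encodable.iUnion_decode₂_disjoint_on fun i j hij => Set.disjoint_left.mpr ?_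
    intro x hi hj
    rw [mem_latticeCube_iff hs] at hi hj
    exact hij (hi.symm.trans hj)
  · rw [Encodable.iUnion_decode₂]
    exact Set.eq_univ_of_forall fun x => Set.mem_iUnion.mpr ⟨_, (mem_latticeCube_iff hs).mpr rfl⟩
  · intro n
    refine Encodable.iUnion_decode₂_cases
      (C := fun A => ∀ x ∈ A, ∀ y ∈ A, dist x y ≤ r) (by simp) ?_
    intro i x hx y hy
    exact hsr ▸ dist_le_of_mem_latticeCube hs hx hy
  · intro n
    exact Encodable.iUnion_decode₂_cases
      (C := fun A => A = ∅ ∨ volume A = ENNReal.ofReal s ^ d) (Or.inl rfl)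
      fun i => Or.inr (volume_latticeCube d s i)

/-- The neighbourhoods of cells of fixed volume overlap boundedly often. -/
theorem tsum_indicator_thickening_le {d : ℕ} {Q : ℕ → Set (RSpace d)} {V : ℝ≥0∞} {r R : ℝ}
    (hV0 : V ≠ 0) (hVtop : V ≠ ∞) (hQ : ∀ n, MeasurableSet (Q n))
    (hdisj : Pairwise (Function.onFun Disjoint Q))
    (hdiam : ∀ n, ∀ x ∈ Q n, ∀ y ∈ Q n, dist x y ≤ r) (hvol : ∀ n, Q n = ∅ ∨ volume (Q n) = V)
    (x : RSpace d) :
    ∑' n, (Metric.thickening R (Q n)).indicator (fun _ => (1 : ℝ≥0∞)) x ≤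
      volume (Metric.closedBall (0 : RSpace d) (R + r)) / V := by
  rw [ENNReal.le_div_iff_mul_le (Or.inl hV0) (Or.inl hVtop), ← ENNReal.tsum_mul_right]
  -- Each cell whose thickening contains `x` lies in the ball of radius `R + r` about `x`. Such
  -- cells are disjoint of volume `V`, so comparing volumes bounds their number.
  calc ∑' n, (Metric.thickening R (Q n)).indicator (fun _ => (1 : ℝ≥0∞)) x * V
      ≤ ∑' n, volume (Q n ∩ Metric.closedBall x (R + r)) := by
        refine ENNReal.tsum_le_tsum fun n => ?_
        by_cases hx : x ∈ Metric.thickening R (Q n)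
        · obtain ⟨q, hq, hxq⟩ := Metric.mem_thickening_iff.mp hx
          have hsub : Q n ⊆ Metric.closedBall x (R + r) := by
            intro y hy
            rw [Metric.mem_closedBall, dist_comm]
            linarith [dist_triangle x q y, hdiam n q hq y hy]
          rw [Set.indicator_of_mem hx, one_mul, Set.inter_eq_left.mpr hsub]
          rcases hvol n with h | h
          · simp [h] at hq
          · exact h.ge
        · simp [hx]
    _ = volume (⋃ n, Q n ∩ Metric.closedBall x (R + r)) := by
        rw [measure_iUnion]
        · exact fun i j hij => (hdisj hij).mono Set.inter_subset_left Set.inter_subset_left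
        · exact fun n => (hQ n).inter Metric.isClosed_closedBall.measurableSet
    _ ≤ volume (Metric.closedBall x (R + r)) :=
        measure_mono (Set.iUnion_subset fun n => Set.inter_subset_right)
    _ = _ := by
      rw [← Measure.addHaar_closedBall_center]

/-! ### Integral inequalities -/

/-- Hölder's inequality against the constant function `1`. -/
theorem pow_lintegral_le {α : Type*} [MeasurableSpace α] {ν : Measure α} {f : α → ℝ≥0∞}
    (hf : AEMeasurable f ν) {k : ℕ} (hk : 0 < k) :
    (∫⁻ x, f x ∂ν) ^ k ≤ ν Set.univ ^ (k - 1) * ∫⁻ x, f x ^ k ∂ν := by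
  have hk0 : (k : ℝ) ≠ 0 := by positivity
  have h := eLpNorm'_le_eLpNorm'_mul_rpow_measure_univ (f := f) (p := 1) (q := k) one_pos
    (by exact_mod_cast hk) hf.aestronglyMeasurable
  simp only [eLpNorm'_eq_lintegral_enorm, enorm_eq_self, ENNReal.rpow_one, div_one,
    ENNReal.rpow_natCast] at h
  calc (∫⁻ x, f x ∂ν) ^ k
      ≤ ((∫⁻ x, f x ^ k ∂ν) ^ (1 / (k : ℝ)) * ν Set.univ ^ (1 - 1 / (k : ℝ))) ^ k := by
        gcongr
    _ = _ := by
        rw [mul_pow, ← ENNReal.rpow_natCast, ← ENNReal.rpow_natCast, ← ENNReal.rpow_mul,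
          ← ENNReal.rpow_mul, one_div_mul_cancel hk0, ENNReal.rpow_one, mul_comm,
          ← ENNReal.rpow_natCast]
        congr 2
        rw [Nat.cast_sub hk]
        field_simp
        simp

/-- The reverse of `pow_lintegral_le` for a function whose values are comparable on `A`. -/
theorem lintegral_pow_le_of_comparable {α : Type*} [MeasurableSpace α] {ν : Measure α}
    {f : α → ℝ≥0∞} {c : ℝ≥0∞} {A : Set α} (hA : MeasurableSet A)
    (hc : c ≠ ∞) (hcomp : ∀ x ∈ A, ∀ y ∈ A, f x ≤ c * f y) (k : ℕ) :
    ν A ^ k * ∫⁻ x in A, f x ^ k ∂ν ≤ (c * ∫⁻ x in A, f x ∂ν) ^ k * ν A := by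
  -- Integrating the comparison over `y ∈ A` bounds each value of `f` by `c` times its average.
  have h1 : ∀ x ∈ A, f x * ν A ≤ c * ∫⁻ y in A, f y ∂ν := by
    intro x hx
    rw [← lintegral_const_mul' _ _ hc, ← setLIntegral_const]
    exact setLIntegral_mono' hA fun y hy => hcomp x hx y hy
  rw [← setLIntegral_const]
  refine (lintegral_const_mul_le _ _).trans ?_
  refine setLIntegral_mono' hA fun x hx => ?_
  rw [← mul_pow, mul_comm]
  exact pow_le_pow_left' (h1 x hx) k

/-! ### Poisson counts: moments, independence, lower bounds -/

/-- The factorial moments of the Poisson distribution. -/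
theorem tsum_descFactorial_mul_poisson (l : ℝ≥0) (k : ℕ) :
    ∑' n : ℕ, (n.descFactorial k : ℝ≥0∞) *
      ENNReal.ofReal (Real.exp (-l) * (l : ℝ) ^ n / (n ! : ℝ)) = (l : ℝ≥0∞) ^ k := by
  -- The terms with `n < k` vanish; shifting by `k` leaves `l ^ k` times the total Poisson mass.
  rw [← Summable.sum_add_tsum_nat_add' (k := k) ENNReal.summable]
  have h0 : ∑ n ∈ Finset.range k, (n.descFactorial k : ℝ≥0∞) *
      ENNReal.ofReal (Real.exp (-l) * (l : ℝ) ^ n / (n ! : ℝ)) = 0 := by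
    refine Finset.sum_eq_zero fun n hn => ?_
    rw [Nat.descFactorial_of_lt (Finset.mem_range.mp hn)]
    simp
  have h1 : ∀ n : ℕ, ((n + k).descFactorial k : ℝ≥0∞) *
      ENNReal.ofReal (Real.exp (-l) * (l : ℝ) ^ (n + k) / ((n + k) ! : ℝ)) =
      (l : ℝ≥0∞) ^ k * ENNReal.ofReal (Real.exp (-l) * (l : ℝ) ^ n / (n ! : ℝ)) := by
    intro n
    have h := Nat.factorial_mul_descFactorial (Nat.le_add_left k n)
    rw [Nat.add_sub_cancel] at h
    have h' : ((n + k) ! : ℝ) = n ! * (n + k).descFactorial k := by exact_mod_cast h.symm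
    have hd : ((n + k).descFactorial k : ℝ) ≠ 0 := by
      have := (Nat.descFactorial_pos (n := n + k) (k := k)).mpr (Nat.le_add_left k n)
      positivity
    have hn : (n ! : ℝ) ≠ 0 := by positivity
    rw [← ENNReal.ofReal_natCast, ← ENNReal.ofReal_mul (by positivity), ← ENNReal.ofReal_coe_nnreal,
      ← ENNReal.ofReal_pow l.coe_nonneg,
      ← ENNReal.ofReal_mul (by positivity), h', pow_add]
    congr 1
    field_simp
  have hs := hasSum_one_poissonMeasure l
  rw [h0, zero_add, tsum_congr h1, ENNReal.tsum_mul_left,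
    ← ENNReal.ofReal_tsum_of_nonneg (fun n => by positivity) hs.summable, hs.tsum_eq,
    ENNReal.ofReal_one, mul_one]

theorem measurable_count {d : ℕ} {A : Set (RSpace d)} (hA : MeasurableSet A) :
    Measurable (PointConfig.count A) :=
  Measurable.of_comap_le (le_iSup₂_of_le A hA le_rfl)

theorem encard_distinctTuples_eq_tsum {d k : ℕ} {A : Set (RSpace d)}
    (hb : Bornology.IsBounded A) (ξ : PointConfig d) :
    ((distinctTuples k (ξ.1 ∩ A)).encard : ℝ≥0∞) =
      ∑' n : ℕ, (n.descFactorial k : ℝ≥0∞) *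
        {ξ : PointConfig d | ξ.count A = n}.indicator (fun _ => 1) ξ := by
  have hfin := ξ.2 A hb
  have hc : ξ.count A = ((ξ.1 ∩ A).ncard : ℕ) := by
    rw [PointConfig.count, hfin.cast_ncard_eq]
  rw [encard_distinctTuples k hfin, tsum_eq_single (ξ.1 ∩ A).ncard]
  · rw [Set.indicator_of_mem (show ξ ∈ {ξ : PointConfig d | ξ.count A = _} from hc), mul_one]
    rfl
  · intro n hn
    rw [Set.indicator_of_notMem, mul_zero]
    intro h
    exact hn (Nat.cast_injective (R := ℕ∞) (h.symm.trans hc))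

theorem measurable_encard_distinctTuples {d k : ℕ} {A : Set (RSpace d)}
    (hA : MeasurableSet A) (hb : Bornology.IsBounded A) :
    Measurable fun ξ : PointConfig d => ((distinctTuples k (ξ.1 ∩ A)).encard : ℝ≥0∞) := by
  simp_rw [encard_distinctTuples_eq_tsum hb]
  exact Measurable.tsum fun n => (measurable_const.indicator
    (measurable_count hA (measurableSet_singleton (n : ℕ∞)))).const_mul _

namespace IsPoissonProcess

variable {d : ℕ} {Ω : Type*} [MeasurableSpace Ω] {P : Measure Ω} {η : Ω → PointConfig d}
  {ν : Measure (RSpace d)}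

theorem measurableSet_count_eq (h : IsPoissonProcess P η ν) {A : Set (RSpace d)}
    (hA : MeasurableSet A) (n : ℕ∞) : MeasurableSet {ω | (η ω).count A = n} :=
  ((measurable_count hA).comp h.measurable) (measurableSet_singleton n)

/-- The expected number of `k`-tuples of distinct points in a bounded set. -/
theorem lintegral_encard_distinctTuples (h : IsPoissonProcess P η ν) {A : Set (RSpace d)}
    (hA : MeasurableSet A) (hb : Bornology.IsBounded A) (hν : ν A < ∞) (k : ℕ) :
    ∫⁻ ω, ((distinctTuples k ((η ω).1 ∩ A)).encard : ℝ≥0∞) ∂P = ν A ^ k := by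
  simp_rw [encard_distinctTuples_eq_tsum hb]
  have hm : ∀ n : ℕ, MeasurableSet {ω | (η ω).count A = n} :=
    fun n => h.measurableSet_count_eq hA n
  have hi : ∀ (n : ℕ) (ω : Ω), {ξ : PointConfig d | ξ.count A = n}.indicator
      (fun _ => (1 : ℝ≥0∞)) (η ω) = {ω | (η ω).count A = n}.indicator (fun _ => 1) ω :=
    fun n ω => rfl
  simp_rw [hi]
  rw [lintegral_tsum fun n => ((measurable_const.indicator (hm n)).const_mul _).aemeasurable]
  have hn : ∀ n : ℕ, ∫⁻ ω, (n.descFactorial k : ℝ≥0∞) *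
      {ω | (η ω).count A = n}.indicator (fun _ => 1) ω ∂P = (n.descFactorial k : ℝ≥0∞) *
      ENNReal.ofReal (Real.exp (-((ν A).toNNReal : ℝ)) * ((ν A).toNNReal : ℝ) ^ n / (n ! : ℝ)) := by
    intro n
    rw [lintegral_const_mul _ (measurable_const.indicator (hm n)), lintegral_indicator (hm n),
      setLIntegral_one, h.law A hA hν n]
    rfl
  rw [tsum_congr hn, tsum_descFactorial_mul_poisson, ENNReal.coe_toNNReal hν.ne]

theorem iIndepSet_count_eq (h : IsPoissonProcess P η ν) {A : ℕ → Set (RSpace d)}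
    (hA : ∀ n, MeasurableSet (A n)) (hdisj : Pairwise (Function.onFun Disjoint A)) (k : ℕ∞) :
    iIndepSet (fun n => {ω | (η ω).count (A n) = k}) P := by
  rw [iIndepSet_iff_meas_biInter fun n => h.measurableSet_count_eq (hA n) k]
  intro s
  have e := s.equivFin.symm
  have hind := h.indep s.card (fun i => A (e i)) (fun i => hA _)
    fun i j hij => hdisj fun he => hij (e.injective (Subtype.ext he))
  have hprod := hind.measure_inter_preimage_eq_mul Finset.univ
    (sets := fun _ => {k}) fun i _ => measurableSet_singleton k
  rw [← Finset.prod_coe_sort, ← e.prod_comp]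
  refine Eq.trans (congrArg P ?_) hprod
  ext ω
  simp only [Set.mem_iInter, Set.mem_ofPred_eq, Set.mem_preimage, Set.mem_singleton_iff,
    Finset.mem_univ, true_imp_iff]
  exact ⟨fun hs i => hs _ (e i).2, fun hs n hn => by simpa using hs (e.symm ⟨n, hn⟩)⟩

/-- Replacing `exp (-ν A)` by `exp (-L)` makes the constant the same for all cells with mass at most
`L`. -/
theorem le_measure_count_eq (h : IsPoissonProcess P η ν) {A : Set (RSpace d)}
    (hA : MeasurableSet A) {L : ℝ≥0} (hL : ν A ≤ L) (k : ℕ) :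
    ENNReal.ofReal (Real.exp (-L) / (k ! : ℝ)) * ν A ^ k ≤ P {ω | (η ω).count A = k} := by
  have hfin : ν A < ∞ := hL.trans_lt ENNReal.coe_lt_top
  have hreal : (ν A).toReal ≤ L := ENNReal.toReal_le_coe_of_le_coe hL
  rw [h.law A hA hfin]
  nth_rw 1 [← ENNReal.ofReal_toReal hfin.ne]
  rw [← ENNReal.ofReal_pow ENNReal.toReal_nonneg, ← ENNReal.ofReal_mul (by positivity)]
  refine ENNReal.ofReal_le_ofReal ?_
  rw [div_mul_eq_mul_div]
  gcongr

end IsPoissonProcess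

/-! ### The two implications and the conclusion -/

theorem subset_closedBall_of_thickening {d : ℕ} {A : Set (RSpace d)} {r R : ℝ}
    (hdiam : ∀ x ∈ A, ∀ y ∈ A, dist x y ≤ r) {x : RSpace d} (hx : x ∈ A) :
    Metric.thickening R A ⊆ Metric.closedBall x (R + r) := by
  intro y hy
  obtain ⟨z, hz, hyz⟩ := Metric.mem_thickening_iff.mp hy
  rw [Metric.mem_closedBall]
  linarith [dist_triangle y z x, hdiam z hz x hx]

theorem ae_subgraphCount_lt_top {d k : ℕ} {H : SimpleGraph (Fin k)} (hH : H.Connected)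
    {S : Set (RSpace d)} {r : ℝ} (hr : 0 < r) (hS : S ⊆ Metric.closedBall 0 r)
    {m : RSpace d → ℝ≥0} (hm : Measurable m) {C : ℝ≥0} (hC : ∀ x, m x ≤ C)
    {Ω : Type*} [MeasurableSpace Ω] {P : Measure Ω} {η : Ω → PointConfig d} {t : ℕ}
    (hη : IsPoissonProcess P η ((t : ℝ≥0∞) • volume.withDensity fun x => (m x : ℝ≥0∞)))
    (hint : ∫⁻ x, (m x : ℝ≥0∞) ^ k < ∞) : ∀ᵐ ω ∂P, subgraphCount S H (η ω) < ∞ := by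
  have hk : 0 < k := Fin.pos_iff_nonempty.mpr hH.nonempty
  have hm' : Measurable fun x => (m x : ℝ≥0∞) := hm.coe_nnreal_ennreal
  obtain ⟨Q, V, hV0, hVtop, hQ, hdisj, hcover, hdiam, hvol⟩ := exists_partition d one_pos
  -- The extra `1` gives the strict inequality needed for the open thickening.
  set R : ℝ := k * r + 1
  set T : ℕ → Set (RSpace d) := fun n => Metric.thickening R (Q n)
  set W : ℝ≥0∞ := volume (Metric.closedBall (0 : RSpace d) (R + 1))
  have hW : W ≠ ∞ := measure_closedBall_lt_top.ne
  have hT : ∀ n, MeasurableSet (T n) := fun n => Metric.isOpen_thickening.measurableSet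
  have hTvol : ∀ n, Bornology.IsBounded (T n) ∧ volume (T n) ≤ W := by
    intro n
    rcases (Q n).eq_empty_or_nonempty with h | ⟨x, hx⟩
    · simp [T, h]
    · have hsub := subset_closedBall_of_thickening (R := R) (hdiam n) hx
      refine ⟨Metric.isBounded_closedBall.subset hsub, (measure_mono hsub).trans_eq ?_⟩
      rw [Measure.addHaar_closedBall_center]
  have hmass : ∀ n, ((t : ℝ≥0∞) • volume.withDensity fun x => (m x : ℝ≥0∞)) (T n) =
      t * ∫⁻ x in T n, m x := by
    intro n
    rw [Measure.smul_apply, withDensity_apply _ (hT n), smul_eq_mul]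
  have hfin : ∀ n, ((t : ℝ≥0∞) • volume.withDensity fun x => (m x : ℝ≥0∞)) (T n) < ∞ := by
    intro n
    rw [hmass]
    refine ENNReal.mul_lt_top (ENNReal.natCast_lt_top t) ?_
    calc ∫⁻ x in T n, (m x : ℝ≥0∞) ≤ ∫⁻ _ in T n, (C : ℝ≥0∞) :=
          lintegral_mono fun x => ENNReal.coe_le_coe.mpr (hC x)
      _ ≤ C * W := by rw [setLIntegral_const]; gcongr; exact (hTvol n).2
      _ < ∞ := ENNReal.mul_lt_top ENNReal.coe_lt_top hW.lt_top
  have hle : ∀ ω, subgraphCount S H (η ω) ≤ ((2 ^ k * 2 ^ (k * k) : ℝ≥0) : ℝ≥0∞) *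
      ∑' n, ((distinctTuples k ((η ω).1 ∩ T n)).encard : ℝ≥0∞) := by
    refine fun ω => uStatistic_le_tsum_encard (subgraphKernel_le S H) (fun x hx => ?_) (η ω)
    obtain ⟨n, hn⟩ := Set.mem_iUnion.mp (hcover.ge (Set.mem_univ (x ⟨0, hk⟩)))
    refine ⟨n, fun i => Metric.mem_thickening_iff.mpr ⟨_, hn, ?_⟩⟩
    exact (dist_le_of_subgraphKernel_ne_zero hr.le hS hH hx _ _).trans_lt (lt_add_one _)
  have hmeas : ∀ n, Measurable fun ω =>
      ((distinctTuples k ((η ω).1 ∩ T n)).encard : ℝ≥0∞) := fun n =>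
    (measurable_encard_distinctTuples (hT n) (hTvol n).1).comp hη.measurable
  have hsum : ∫⁻ ω, ∑' n, ((distinctTuples k ((η ω).1 ∩ T n)).encard : ℝ≥0∞) ∂P ≠ ∞ := by
    rw [lintegral_tsum fun n => (hmeas n).aemeasurable]
    refine ne_top_of_le_ne_top (b := (t : ℝ≥0∞) ^ k * (W ^ (k - 1) *
      ((∫⁻ x, (m x : ℝ≥0∞) ^ k) * (W / V)))) ?_ ?_
    · exact ENNReal.mul_ne_top (ENNReal.pow_ne_top (ENNReal.natCast_ne_top t))
        (ENNReal.mul_ne_top (ENNReal.pow_ne_top hW)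
          (ENNReal.mul_ne_top hint.ne (ENNReal.div_ne_top hW hV0)))
    calc ∑' n, ∫⁻ ω, ((distinctTuples k ((η ω).1 ∩ T n)).encard : ℝ≥0∞) ∂P
        ≤ ∑' n, (t : ℝ≥0∞) ^ k * (W ^ (k - 1) * ∫⁻ x in T n, (m x : ℝ≥0∞) ^ k) := by
          refine ENNReal.tsum_le_tsum fun n => ?_
          rw [hη.lintegral_encard_distinctTuples (hT n) (hTvol n).1 (hfin n), hmass, mul_pow]
          gcongr
          refine (pow_lintegral_le hm'.aemeasurable hk).trans ?_
          rw [Measure.restrict_apply_univ]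
          gcongr
          exact (hTvol n).2
      _ = (t : ℝ≥0∞) ^ k * (W ^ (k - 1) * ∫⁻ x, (m x : ℝ≥0∞) ^ k *
            ∑' n, (T n).indicator (fun _ => (1 : ℝ≥0∞)) x) := by
          rw [ENNReal.tsum_mul_left, ENNReal.tsum_mul_left]
          simp_rw [← ENNReal.tsum_mul_left]
          rw [lintegral_tsum (f := fun n x => (m x : ℝ≥0∞) ^ k *
            (T n).indicator (fun _ => (1 : ℝ≥0∞)) x) fun n =>
            ((hm'.pow_const k).mul (measurable_const.indicator (hT n))).aemeasurable,
            ENNReal.tsum_mul_left, ENNReal.tsum_mul_left]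
          congr 3 with n
          rw [← lintegral_indicator (hT n)]
          refine lintegral_congr fun x => ?_
          by_cases hx : x ∈ T n <;> simp [hx]
      _ ≤ _ := by
          rw [← lintegral_mul_const _ (hm'.pow_const k)]
          gcongr with x
          exact tsum_indicator_thickening_le hV0 hVtop hQ hdisj hdiam hvol x
  filter_upwards [ae_lt_top (Measurable.tsum hmeas) hsum] with ω hω
  exact (hle ω).trans_lt (ENNReal.mul_lt_top ENNReal.coe_lt_top hω)

theorem lintegral_pow_lt_top_of_ae_subgraphCount_lt_top {d k : ℕ} (hk : 0 < k)
    (H : SimpleGraph (Fin k)) {S : Set (RSpace d)} {r : ℝ} (hr : 0 < r)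
    (hS : Metric.closedBall 0 r ⊆ S)
    {m : RSpace d → ℝ≥0} {C : ℝ≥0} (hC : ∀ x, m x ≤ C)
    {c : ℝ≥0} (hcomp : 1 < k → ∀ x y, dist x y ≤ r → m x ≤ c * m y)
    {Ω : Type*} [MeasurableSpace Ω] {P : Measure Ω} [IsProbabilityMeasure P]
    {η : Ω → PointConfig d} {t : ℕ} (ht : 0 < t)
    (hη : IsPoissonProcess P η ((t : ℝ≥0∞) • volume.withDensity fun x => (m x : ℝ≥0∞)))
    (hfin : ∀ᵐ ω ∂P, subgraphCount S H (η ω) < ∞) : ∫⁻ x, (m x : ℝ≥0∞) ^ k < ∞ := by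
  obtain ⟨Q, V, hV0, hVtop, hQ, hdisj, hcover, hdiam, hvol⟩ := exists_partition d hr
  lift V to ℝ≥0 using hVtop
  set ν : Measure (RSpace d) := (t : ℝ≥0∞) • volume.withDensity fun x => (m x : ℝ≥0∞) with hν_def
  have hmass : ∀ n, ν (Q n) = t * ∫⁻ x in Q n, m x := by
    intro n
    rw [hν_def, Measure.smul_apply, withDensity_apply _ (hQ n), smul_eq_mul]
  have hmass_ge : ∀ n, ∫⁻ x in Q n, (m x : ℝ≥0∞) ≤ ν (Q n) := by
    intro n
    rw [hmass]
    exact le_mul_of_one_le_left zero_le (by exact_mod_cast ht)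
  have hmass_le : ∀ n, ν (Q n) ≤ ((t * (C * V) : ℝ≥0) : ℝ≥0∞) := by
    intro n
    rw [hmass]
    push_cast
    gcongr
    calc ∫⁻ x in Q n, (m x : ℝ≥0∞) ≤ ∫⁻ _ in Q n, (C : ℝ≥0∞) :=
          lintegral_mono fun x => ENNReal.coe_le_coe.mpr (hC x)
      _ ≤ C * V := by
          rw [setLIntegral_const]
          gcongr
          rcases hvol n with h | h <;> simp [h]
  obtain ⟨D, hD, hDle⟩ : ∃ D : ℝ≥0∞, D ≠ ∞ ∧
      ∀ n, ∫⁻ x in Q n, (m x : ℝ≥0∞) ^ k ≤ D * ν (Q n) ^ k := by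
    -- For `k = 1` the diameter of `H` is `0` and no comparability is available, but then both sides
    -- are linear in `m`.
    by_cases h1 : 1 < k
    · refine ⟨(c : ℝ≥0∞) ^ k * (V / (V : ℝ≥0∞) ^ k), ENNReal.mul_ne_top
        (ENNReal.pow_ne_top ENNReal.coe_ne_top)
        (ENNReal.div_ne_top ENNReal.coe_ne_top (pow_ne_zero k hV0)), fun n => ?_⟩
      rcases hvol n with h | h
      · simp [h]
      have hle := lintegral_pow_le_of_comparable (ν := volume) (f := fun x => (m x : ℝ≥0∞))
        (hQ n) (ENNReal.coe_ne_top (r := c))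
        (fun x hx y hy => by exact_mod_cast hcomp h1 x y (hdiam n x hx y hy)) k
      rw [h, mul_comm, ← ENNReal.le_div_iff_mul_le (Or.inl (pow_ne_zero k hV0))
        (Or.inl (ENNReal.pow_ne_top ENNReal.coe_ne_top))] at hle
      refine hle.trans ?_
      rw [mul_pow, mul_div_assoc, mul_right_comm]
      gcongr
      exact hmass_ge n
    · obtain rfl : k = 1 := by omega
      exact ⟨1, ENNReal.one_ne_top, fun n => by simpa using hmass_ge n⟩
  set ε := ENNReal.ofReal (Real.exp (-((t * (C * V) : ℝ≥0) : ℝ)) / (k ! : ℝ))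
  have hε : ε ≠ 0 := (ENNReal.ofReal_pos.mpr (by positivity)).ne'
  -- Second Borel–Cantelli: if `∫ m^k = ∞`, the probabilities of having exactly `k` points in `Q n`
  -- have infinite sum.
  by_contra htop
  rw [not_lt_top_iff] at htop
  have hsum : ∑' n, P {ω | (η ω).count (Q n) = k} = ∞ := by
    by_contra hne
    have h2 : ε * ∫⁻ x, (m x : ℝ≥0∞) ^ k ≤ D * ∑' n, P {ω | (η ω).count (Q n) = k} := by
      rw [← setLIntegral_univ, ← hcover, lintegral_iUnion hQ hdisj, ← ENNReal.tsum_mul_left,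
        ← ENNReal.tsum_mul_left]
      refine ENNReal.tsum_le_tsum fun n => ?_
      calc ε * ∫⁻ x in Q n, (m x : ℝ≥0∞) ^ k ≤ ε * (D * ν (Q n) ^ k) := by gcongr; exact hDle n
        _ = D * (ε * ν (Q n) ^ k) := by ring
        _ ≤ _ := by gcongr; exact hη.le_measure_count_eq (hQ n) (hmass_le n) k
    rw [htop, ENNReal.mul_top hε] at h2
    exact ENNReal.mul_ne_top hD hne (top_unique h2)
  have hone := measure_limsup_eq_one
    (fun n => hη.measurableSet_count_eq (hQ n) k) (hη.iIndepSet_count_eq hQ hdisj k) hsum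
  have hmeas : MeasurableSet (limsup (fun n => {ω | (η ω).count (Q n) = k}) atTop) :=
    MeasurableSet.measurableSet_limsup fun n => hη.measurableSet_count_eq (hQ n) k
  have hae := (prob_compl_eq_zero_iff hmeas).mpr hone
  have hfreq : ∀ᵐ ω ∂P, ω ∈ limsup (fun n => {ω | (η ω).count (Q n) = k}) atTop :=
    mem_ae_iff.mpr hae
  obtain ⟨ω, h1, h2⟩ := (hfin.and hfreq).exists
  rw [mem_limsup_iff_frequently_mem, Nat.frequently_atTop_iff_infinite] at h2
  refine h1.ne (uStatistic_eq_top hk (ε := 1 / (k ! : ℝ≥0)) (by positivity) hdisj ?_ h2)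
  refine fun n x hx hmem => le_subgraphKernel H hx fun i j => hS ?_
  simpa [dist_eq_norm] using hdiam n _ (hmem i) _ (hmem j)

theorem proposition4p1 {d k : ℕ} (H : SimpleGraph (Fin k)) (hH : H.Connected)
    -- the shape `S` of the neighbourhoods
    (S : Set (RSpace d)) (θ : ℝ) (hθ : 1 ≤ θ) (hSsymm : S = -S)
    (hSlow : Metric.closedBall 0 1 ⊆ S) (hSup : S ⊆ Metric.closedBall 0 θ)
    -- the scaling sequence
    (ρ : ℕ+ → ℝ) (hρpos : ∀ t, 0 < ρ t) (hρlim : Tendsto ρ atTop (𝓝 0))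
    -- the bounded density, comparable at nearby points
    (m : RSpace d → ℝ≥0) (hm : Measurable m) (hmbdd : ∃ C : ℝ≥0, ∀ x, m x ≤ C)
    (hmcomp : ∃ c : ℝ≥0, 1 ≤ c ∧ ∀ x y : RSpace d,
      ‖x - y‖ ≤ (H.diam : ℝ) * θ * ⨆ t, ρ t → m x ≤ c * m y)
    -- the Poisson processes with intensity measures `t • μ`, where `μ` has density `m`
    {Ω : Type*} [MeasurableSpace Ω] (P : Measure Ω) [IsProbabilityMeasure P]
    (η : ℕ+ → Ω → PointConfig d)
    (hη : ∀ t : ℕ+, IsPoissonProcess P (η t)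
      (((t : ℕ) : ℝ≥0∞) • volume.withDensity fun x => (m x : ℝ≥0∞)))
    (t : ℕ+) :
    (∀ᵐ ω ∂P, subgraphCount (ρ t • S) H (η t ω) < ∞) ↔
      ∫⁻ x, (m x : ℝ≥0∞) ^ k < ∞ := by
  obtain ⟨C, hC⟩ := hmbdd
  obtain ⟨c, -, hc⟩ := hmcomp
  have hk : 0 < k := Fin.pos_iff_nonempty.mpr hH.nonempty
  have hρt := hρpos t
  have hball : ∀ s : ℝ, 0 ≤ s →
      ρ t • Metric.closedBall (0 : RSpace d) s = Metric.closedBall 0 (ρ t * s) := by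
    intro s hs
    rw [smul_closedBall _ _ hs, smul_zero, Real.norm_of_nonneg hρt.le]
  constructor
  · refine lintegral_pow_lt_top_of_ae_subgraphCount_lt_top hk H hρt ?_ hC (c := c) (fun h1 x y hxy => ?_)
      t.pos (hη t)
    · have := Set.smul_set_mono (a := ρ t) hSlow
      rwa [hball 1 zero_le_one, mul_one] at this
    · refine hc x y ?_
      rw [← dist_eq_norm]
      have : Nontrivial (Fin k) := Fin.nontrivial_iff_two_le.mpr h1
      have hdiam : (1 : ℝ) ≤ H.diam := by
        exact_mod_cast Nat.one_le_iff_ne_zero.mpr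
          (SimpleGraph.connected_iff_diam_ne_zero.mp hH)
      -- Convergence of `ρ` bounds its range, so the real supremum is genuine and not the default
      -- value `0`.
      have hbdd : BddAbove (Set.range ρ) := by
        have := (hρlim.comp OrderIso.pnatIsoNat.symm.tendsto_atTop).bddAbove_range
        rwa [OrderIso.pnatIsoNat.symm.surjective.range_comp] at this
      have hsup : ρ t ≤ ⨆ t, ρ t := le_ciSup hbdd t
      have hprod : 1 ≤ (H.diam : ℝ) * θ := one_le_mul_of_one_le_of_one_le hdiam hθ
      nlinarith
  · refine ae_subgraphCount_lt_top hH (r := ρ t * θ) (by positivity) ?_ hm hC (hη t)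
    rw [← hball θ (by positivity)]
    exact Set.smul_set_mono hSup
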